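/- Let $d\ge 1$, let $I$ be a finite set, and for each $i\in I$ let $A_i\in\mathbb{R}^{d\times d}$ be an invertible matrix with $\|A_i\|<1$ (Euclidean operator norm) and $a_i\in\mathbb{R}^d$ a vector. For a finite word $\mathtt{i}=(i_1,\dots,i_n)$ put $A_{\mathtt{i}}=A_{i_1}\cdots A_{i_n}$ (the identity for the empty word), and for $\mathtt{i}=(i_1,i_2,\dots)\in I^{\mathbb{N}}$ write $\mathtt{i}|_n=(i_1,\dots,i_n)$ and $\pi(\mathtt{i})=\sum_{n=1}^\infty A_{\mathtt{i}|_{n-1}}a_{i_n}$. Let $K\subset I^{\mathbb{N}}$ be nonempty, compact (in the product topology, $I$ being discrete) and satisfy $\sigma(K)\subset K$, where $\sigma(i_1,i_2,\dots)=(i_2,i_3,\dots)$. Put $K_n=\{\mathtt{i}|_n:\mathtt{i}\in K\}$, $K_*=\bigcup_{n\ge1}K_n$ and $E_K=\pi(K)$, and for a finite word $\mathtt{i}$ let $E_{\mathtt{i}}=\pi(\{\mathtt{j}\in I^{\mathbb N}:\mathtt{j}\text{ begins with }\mathtt{i}\})$. For an invertible matrix $A$ with singular values $\alpha_1(A)\ge\dots\ge\alpha_d(A)>0$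 let $\varphi^t(A)=\alpha_1(A)\cdots\alpha_l(A)\,\alpha_{l+1}(A)^{t-l}$ with $l=\lfloor t\rfloor$ if $0\le t<d$, and $\varphi^t(A)=|\det A|^{t/d}$ if $t\ge d$. The topological pressure is $$P_K(t)=\lim_{n\to\infty}\tfrac1n\log\sum_{\mathtt{i}\in K_n}\varphi^t(A_{\mathtt{i}})$$ (the limit exists by subadditivity). Assume that $E_K$ is tractable: with $\mathcal{Q}_d$ the set of vectors in $\mathbb{R}^d$ with strictly positive coordinates, $A_i(\overline{\mathcal{Q}_d})\subset\mathcal{Q}_d\cup\{0\}$ for every $i\in I$, and $E_K$ is not contained in any (affine) hyperplane of $\mathbb{R}^d$. Assume also that $E_K$ satisfies the ball condition: there is $0<\delta<1$ such that for each $x\in E_K$ there is $r_0>0$ such that for every $0<r<r_0$, with $$Z(x,r)=\{\mathtt{i}\in K_*:\operatorname{diam}(E_{\mathtt{i}})\le r<\operatorname{diam}(E_{\mathtt{i}^-}),\ E_{\mathtt{i}}\cap B(x,r)\ne\emptyset\}$$ ($\mathtt{i}^-$ is $\mathtt{i}$ without its last letter and $B(x,r)$ is the closed ball), one can choose points $x_{\mathtt{i}}\in\operatorname{conv}(E_{\mathtt{i}})$,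 $\mathtt{i}\in Z(x,r)$, for which the balls $B(x_{\mathtt{i}},\delta r)$, $\mathtt{i}\in Z(x,r)$, are pairwise disjoint. If $P_K(s)=0$ for some $0<s\le1$, then the Hausdorff dimension and the upper Minkowski dimension of $E_K$ are both equal to $s$: $$\dim_H(E_K)=\overline{\dim}_M(E_K)=s.$$ -/

import Mathlib

open Filter Topology Metric
open scoped NNReal ENNReal

noncomputable section

namespace SubSelfAffine

/-! ### Symbol space -/

/-- The left shift `σ(i₁, i₂, …) = (i₂, i₃, …)` on the symbol space `I^∞ = ℕ → I`. -/
def shift {I : Type*} (i : ℕ → I) : ℕ → I := fun n => i (n + 1)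

/-- The word `i|ₙ` of the first `n` letters of `i`; finite words are lists. -/
def initialWord {I : Type*} (i : ℕ → I) (n : ℕ) : List I := List.ofFn fun k : Fin n => i k

/-- The cylinder `[w]` of all infinite symbols that begin with the word `w`. -/
def cylinder {I : Type*} (w : List I) : Set (ℕ → I) := {i | initialWord i w.length = w}

/-- `K_n = {i|ₙ : i ∈ K}`. -/
def levelWords {I : Type*} (K : Set (ℕ → I)) (n : ℕ) : Set (List I) :=
  (fun i => initialWord i n) '' K

/-- `K_* = ⋃_{n ≥ 1} K_n`. -/
def finiteWords {I : Type*} (K : Set (ℕ → I)) : Set (List I) :=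
  {w | ∃ n : ℕ, 1 ≤ n ∧ w ∈ levelWords K n}

theorem levelWords_finite {I : Type*} [Finite I] (K : Set (ℕ → I)) (n : ℕ) :
    (levelWords K n).Finite := by
  refine (List.finite_length_eq I n).subset ?_
  rintro w ⟨i, -, rfl⟩
  simp [initialWord]

/-! ### Matrix products, singular value function, pressure -/

/-- The product `A_w = A_{i₁} ⋯ A_{iₙ}` for `w = (i₁, …, iₙ)`; the empty product is the identity. -/
def wordMatrix {I : Type*} {d : ℕ} (A : I → Matrix (Fin d) (Fin d) ℝ) (w : List I) :
    Matrix (Fin d) (Fin d) ℝ :=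
  (w.map A).prod

/-- A matrix as an operator on Euclidean space `ℝ^d`. -/
def euclideanMap {d : ℕ} (A : Matrix (Fin d) (Fin d) ℝ) :
    EuclideanSpace ℝ (Fin d) →L[ℝ] EuclideanSpace ℝ (Fin d) :=
  Matrix.toEuclideanCLM (𝕜 := ℝ) A

/-- The singular values in decreasing order, counted from `0`: `singularValue A k = α_{k+1}(A)`. -/
def singularValue {d : ℕ} (A : Matrix (Fin d) (Fin d) ℝ) (k : ℕ) : ℝ :=
  (euclideanMap A).toLinearMap.singularValues k

/-- The singular value function: `φ^t(A) = α₁(A) ⋯ α_l(A) α_{l+1}(A)^{t-l}` with `l = ⌊t⌋` for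
`0 ≤ t < d`, and `φ^t(A) = |det A|^{t/d}` for `t ≥ d`. -/
def singularValueFunction {d : ℕ} (t : ℝ) (A : Matrix (Fin d) (Fin d) ℝ) : ℝ :=
  if t < d then
    (∏ k ∈ Finset.range ⌊t⌋₊, singularValue A k) * singularValue A ⌊t⌋₊ ^ (t - (⌊t⌋₊ : ℝ))
  else |A.det| ^ (t / (d : ℝ))

/-- The topological pressure `P_K(t) = lim_{n → ∞} (1/n) log ∑_{w ∈ K_n} φ^t(A_w)`. For nonempty
shift-invariant `K` and invertible `A_i` the sequence converges, by subadditivity. -/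
def pressure {I : Type*} [Finite I] {d : ℕ} (A : I → Matrix (Fin d) (Fin d) ℝ)
    (K : Set (ℕ → I)) (t : ℝ) : ℝ :=
  limUnder atTop fun n : ℕ =>
    (1 / (n : ℝ)) *
      Real.log (∑ w ∈ (levelWords_finite K n).toFinset, singularValueFunction t (wordMatrix A w))

/-! ### Sub-self-affine sets -/

/-- The projection `π_a(i) = ∑_{n ≥ 1} A_{i|_{n-1}} a_{i_n}`, with letters counted from `0`. The
series converges when the matrices are contractive. -/
def projection {I : Type*} {d : ℕ} (A : I → Matrix (Fin d) (Fin d) ℝ)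
    (a : I → EuclideanSpace ℝ (Fin d)) (i : ℕ → I) : EuclideanSpace ℝ (Fin d) :=
  ∑' n : ℕ, euclideanMap (wordMatrix A (initialWord i n)) (a (i n))

/-- `E_K = π_a(K)`. -/
def limitSet {I : Type*} {d : ℕ} (A : I → Matrix (Fin d) (Fin d) ℝ)
    (a : I → EuclideanSpace ℝ (Fin d)) (K : Set (ℕ → I)) : Set (EuclideanSpace ℝ (Fin d)) :=
  projection A a '' K

/-- `E_w = π_a([w])`; for the empty word this is the self-affine set `E`. -/
def cylinderSet {I : Type*} {d : ℕ} (A : I → Matrix (Fin d) (Fin d) ℝ)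
    (a : I → EuclideanSpace ℝ (Fin d)) (w : List I) : Set (EuclideanSpace ℝ (Fin d)) :=
  projection A a '' cylinder w

/-- The cone `𝒬_d` of vectors with strictly positive coordinates. -/
def openPositiveCone (d : ℕ) : Set (EuclideanSpace ℝ (Fin d)) := {v | ∀ k, 0 < v k}

/-- Tractability (for invertible contractive `A_i`): every `A_i` maps the closed positive cone into
the open one together with the origin, and `E_K` lies in no affine hyperplane of `ℝ^d`. -/
structure IsTractable {I : Type*} {d : ℕ} (A : I → Matrix (Fin d) (Fin d) ℝ)
    (a : I → EuclideanSpace ℝ (Fin d)) (K : Set (ℕ → I)) : Prop where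
  maps_cone : ∀ i, euclideanMap (A i) '' closure (openPositiveCone d) ⊆ openPositiveCone d ∪ {0}
  not_subset_hyperplane : ∀ v : EuclideanSpace ℝ (Fin d), v ≠ 0 → ∀ c : ℝ,
    ¬ limitSet A a K ⊆ {x | inner ℝ v x = c}

/-- `Z(r) = {w ∈ K_* : diam E_w ≤ r < diam E_{w⁻}}`, where `w⁻` is `w` without its last letter. -/
def stoppingWords {I : Type*} {d : ℕ} (A : I → Matrix (Fin d) (Fin d) ℝ)
    (a : I → EuclideanSpace ℝ (Fin d)) (K : Set (ℕ → I)) (r : ℝ) : Set (List I) :=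
  {w | w ∈ finiteWords K ∧ diam (cylinderSet A a w) ≤ r ∧ r < diam (cylinderSet A a w.dropLast)}

/-- `Z(x, r) = {w ∈ Z(r) : E_w ∩ B(x, r) ≠ ∅}`. -/
def stoppingWordsAt {I : Type*} {d : ℕ} (A : I → Matrix (Fin d) (Fin d) ℝ)
    (a : I → EuclideanSpace ℝ (Fin d)) (K : Set (ℕ → I)) (x : EuclideanSpace ℝ (Fin d)) (r : ℝ) :
    Set (List I) :=
  {w | w ∈ stoppingWords A a K r ∧ (cylinderSet A a w ∩ closedBall x r).Nonempty}

/-- The ball condition. The balls are indexed by the words, so that distinct words have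
disjoint balls. -/
def BallCondition {I : Type*} {d : ℕ} (A : I → Matrix (Fin d) (Fin d) ℝ)
    (a : I → EuclideanSpace ℝ (Fin d)) (K : Set (ℕ → I)) : Prop :=
  ∃ δ : ℝ, 0 < δ ∧ δ < 1 ∧ ∀ x ∈ limitSet A a K, ∃ r₀ : ℝ, 0 < r₀ ∧ ∀ r : ℝ, 0 < r → r < r₀ →
    ∃ p : List I → EuclideanSpace ℝ (Fin d),
      (∀ w ∈ stoppingWordsAt A a K x r, p w ∈ convexHull ℝ (cylinderSet A a w)) ∧
      (stoppingWordsAt A a K x r).PairwiseDisjoint fun w => closedBall (p w) (δ * r)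

/-! ### Upper Minkowski dimension -/

/-- The upper Minkowski dimension `inf {t ≥ 0 : limsup_{ε ↓ 0} N(S, ε) ε^t = 0}`, where `N(S, ε)` is
the least number of closed balls of radius `ε` that cover `S`. -/
def upperMinkowskiDim {X : Type*} [PseudoEMetricSpace X] (S : Set X) : ℝ≥0∞ :=
  ⨅ (t : ℝ≥0) (_ : limsup (fun ε : ℝ≥0 =>
      ((externalCoveringNumber ε S : ℕ∞) : ℝ≥0∞) * (ε : ℝ≥0∞) ^ (t : ℝ)) (𝓝[>] 0) = 0), (t : ℝ≥0∞)

end SubSelfAffine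

end

noncomputable section

namespace SubSelfAffine

/-! ### The operator norm as the largest singular value -/

/-! Since `0 < s ≤ 1`, the singular value function is just `‖A‖ ^ s`, and the pressure is the growth
rate of the sums `S_n = ∑_{w ∈ K_n} ‖A_w‖ ^ s` (`levelSum`). Shift invariance makes `S_n`
submultiplicative, so by Fekete's lemma `P_K(s) = 0` is the infimum of `(1/n) log S_n`. Hence `S_n ≥
1` for all `n ≥ 1`, and `S_n` grows subexponentially (`levelSum_of_pressure_eq_zero`). The first
fact gives the lower bound, the second the upper bound.

Lower bound. No measure on `K` is constructed; covers are compared directly. A finite cylinder cover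
of `K` of weight `ρ = ∑ ‖A_w‖ ^ s < 1` would allow words to be cut at their prefixes in the cover,
again and again, forcing `S_n → 0` along multiples of the maximal length; so every finite cover, and
by compactness every countable one, has weight at least `1` (`one_le_tsum_of_cover`). If `dim_H E_K
< s`, then `E_K` has covers with arbitrarily small `∑ diam ^ s`. The ball condition replaces each
covering set by at most `N` cylinders of diameter comparable to it or less, and since `E_K` lies in
no hyperplane, `‖A_w‖ ≤ C diam E_w` (`exists_wordNorm_le_diam`). This yields a cylinder cover of
weight below `1`, a contradiction.

Upper bound. For `u > s` the sum of `‖A_w‖ ^ u` over all words of `K` converges. Stopping each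
symbol when `R ‖A_w‖` first drops to `r` gives a cover by sets of diameter at most `r`, and each
stopped word has weight at least a constant times `r ^ u`; so the covering numbers are `O(r ^
(-u))`. The chain is closed by `dimH_le_upperMinkowskiDim`. -/

theorem singularValue_zero_eq_norm {d : ℕ} (hd : 1 ≤ d) (A : Matrix (Fin d) (Fin d) ℝ) :
    singularValue A 0 = ‖euclideanMap A‖ := by
  set T := (euclideanMap A).toLinearMap with hT
  have hfr : Module.finrank ℝ (EuclideanSpace ℝ (Fin d)) = d := by simp
  have hsq : ∀ v, ‖T v‖ ^ 2 = inner ℝ (LinearMap.adjoint T (T v)) v := fun v => by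
    rw [LinearMap.adjoint_inner_left, real_inner_self_eq_norm_sq]
  have hnn : 0 ≤ T.singularValues 0 := T.singularValues_nonneg 0
  change T.singularValues 0 = _
  apply le_antisymm
  -- A top eigenvector of `T* T` is stretched by exactly the largest singular value; the other
  -- inequality expands `x` in an eigenbasis of `T* T`.
  · obtain ⟨v, hv⟩ := (T.hasEigenvalue_adjoint_comp_self_sq_singularValues
      (n := 0) (by rw [hfr]; omega)).exists_hasEigenvector
    have h1 : LinearMap.adjoint T (T v) = (T.singularValues 0 ^ 2 : ℝ) • v := by
      simpa using hv.apply_eq_smul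
    have h2 : ‖T v‖ ^ 2 = (T.singularValues 0 * ‖v‖) ^ 2 := by
      rw [hsq, h1, inner_smul_left, real_inner_self_eq_norm_sq, mul_pow]; simp
    have h3 : ‖T v‖ = T.singularValues 0 * ‖v‖ :=
      (pow_left_inj₀ (norm_nonneg _) (by positivity) two_ne_zero).1 h2
    have h4 : ‖T v‖ ≤ ‖euclideanMap A‖ * ‖v‖ := (euclideanMap A).le_opNorm v
    exact le_of_mul_le_mul_right (h3 ▸ h4) (norm_pos_iff.2 hv.2)
  · refine ContinuousLinearMap.opNorm_le_bound _ hnn fun x => ?_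
    change ‖T x‖ ≤ _
    refine le_of_sq_le_sq ?_ (by positivity)
    have hS := T.isSymmetric_adjoint_comp_self
    rw [hsq, mul_pow]
    set b := hS.eigenvectorBasis hfr
    have h1 : inner ℝ (LinearMap.adjoint T (T x)) x =
        ∑ i, (b.repr x i) ^ 2 * T.singularValues i ^ 2 := by
      rw [← b.repr.inner_map_map, PiLp.inner_apply]
      refine Finset.sum_congr rfl fun i _ => ?_
      have := hS.eigenvectorBasis_apply_self_apply hfr x i
      simp only [LinearMap.comp_apply] at this
      rw [show b.repr ((LinearMap.adjoint T) (T x)) i = _ from this, T.sq_singularValues_fin hfr]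
      simp [b]; ring
    have h2 : ‖x‖ ^ 2 = ∑ i, (b.repr x i) ^ 2 := by
      rw [← b.repr.norm_map, EuclideanSpace.norm_sq_eq]; simp
    rw [h1, h2, Finset.mul_sum]
    refine Finset.sum_le_sum fun i _ => ?_
    rw [mul_comm]
    gcongr
    · exact T.singularValues_nonneg _
    · exact T.singularValues_antitone (Nat.zero_le _)

/-- Only `α₁` enters: at `t = 1 < d` the remaining factor is `α₂ ^ 0 = 1`, and `t ≥ d` forces `d =
1`, where `|det A|` is the norm. -/
theorem singularValueFunction_eq_norm_rpow {d : ℕ} (hd : 1 ≤ d) {t : ℝ} (h0 : 0 < t) (h1 : t ≤ 1)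
    (A : Matrix (Fin d) (Fin d) ℝ) : singularValueFunction t A = ‖euclideanMap A‖ ^ t := by
  unfold singularValueFunction
  split_ifs with h
  · rcases h1.lt_or_eq with h1 | rfl
    · have : ⌊t⌋₊ = 0 := Nat.floor_eq_zero.2 h1
      simp [this, singularValue_zero_eq_norm hd]
    · simp [singularValue_zero_eq_norm hd]
  · have hd1 : (1 : ℝ) ≤ d := by exact_mod_cast hd
    obtain rfl : d = 1 := by
      have : (d : ℝ) ≤ 1 := by linarith
      exact le_antisymm (by exact_mod_cast this) hd
    have hA : A = A 0 0 • (1 : Matrix (Fin 1) (Fin 1) ℝ) := by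
      ext i j; simp [Subsingleton.elim i 0, Subsingleton.elim j 0]
    have hn : ‖euclideanMap A‖ = |A 0 0| := by
      conv_lhs => rw [hA]
      rw [euclideanMap, map_smul, map_one, norm_smul, norm_one, mul_one, Real.norm_eq_abs]
    rw [hn]; simp

/-! ### Words and shifts -/

theorem iterate_shift {I : Type*} (i : ℕ → I) (m : ℕ) : shift^[m] i = fun n => i (n + m) := by
  induction m generalizing i with
  | zero => rfl
  | succ m ih => rw [Function.iterate_succ_apply, ih]; ext n; simp [shift]; congr 1

theorem iterate_shift_mem {I : Type*} {K : Set (ℕ → I)} (hK : shift '' K ⊆ K) {i : ℕ → I}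
    (hi : i ∈ K) (m : ℕ) : shift^[m] i ∈ K :=
  (Set.mapsTo_iff_image_subset.2 hK).iterate m hi

@[simp]
theorem length_initialWord {I : Type*} (i : ℕ → I) (n : ℕ) : (initialWord i n).length = n := by
  simp [initialWord]

theorem initialWord_add {I : Type*} (i : ℕ → I) (m n : ℕ) :
    initialWord i (m + n) = initialWord i m ++ initialWord (shift^[m] i) n := by
  simp only [initialWord, List.ofFn_add, iterate_shift]
  simp [add_comm]

theorem initialWord_succ {I : Type*} (i : ℕ → I) (n : ℕ) :
    initialWord i (n + 1) = initialWord i n ++ [i n] := by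
  rw [initialWord_add, iterate_shift]; simp [initialWord]

theorem dropLast_initialWord_succ {I : Type*} (i : ℕ → I) (n : ℕ) :
    (initialWord i (n + 1)).dropLast = initialWord i n := by
  rw [initialWord_succ]; simp

theorem mem_cylinder_initialWord {I : Type*} (i : ℕ → I) (n : ℕ) :
    i ∈ cylinder (initialWord i n) := by simp [cylinder]

theorem exists_mem_cylinder_iterate_shift_eq {I : Type*} (w : List I) (i : ℕ → I) :
    ∃ j ∈ cylinder w, shift^[w.length] j = i := by
  refine ⟨fun n => if h : n < w.length then w[n] else i (n - w.length), ?_, ?_⟩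
  · simp only [cylinder, initialWord, Set.mem_ofPred_eq]
    refine List.ext_getElem (by simp) fun n h1 h2 => by simp
  · rw [iterate_shift]; ext n; simp

theorem isOpen_cylinder {I : Type*} [TopologicalSpace I] [DiscreteTopology I] (w : List I) :
    IsOpen (cylinder w) := by
  have : cylinder w = ⋂ k : Fin w.length, (fun i : ℕ → I => i k) ⁻¹' {w[k]} := by
    ext i
    simp only [cylinder, initialWord, Set.mem_ofPred_eq, Set.mem_iInter, Set.mem_preimage,
      Set.mem_singleton_iff]
    constructor
    · intro h k
      have := List.getElem_of_eq h (i := k) (by simp)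
      simpa using this
    · intro h
      refine List.ext_getElem (by simp) fun n h1 h2 => by simpa using h ⟨n, h2⟩
  rw [this]
  exact isOpen_iInter_of_finite fun k =>
    (isOpen_discrete _).preimage (continuous_apply _)

/-! ### Norms of matrix products -/

/-- The operator norm of `A_w`. -/
def wordNorm {I : Type*} {d : ℕ} (A : I → Matrix (Fin d) (Fin d) ℝ) (w : List I) : ℝ :=
  ‖euclideanMap (wordMatrix A w)‖

section
variable {I : Type*} {d : ℕ} {A : I → Matrix (Fin d) (Fin d) ℝ}

theorem wordNorm_nonneg (w : List I) : 0 ≤ wordNorm A w := norm_nonneg _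

theorem euclideanMap_wordMatrix_append (v w : List I) :
    euclideanMap (wordMatrix A (v ++ w)) =
      euclideanMap (wordMatrix A v) * euclideanMap (wordMatrix A w) := by
  simp [wordMatrix, euclideanMap]

theorem wordNorm_append_le (v w : List I) :
    wordNorm A (v ++ w) ≤ wordNorm A v * wordNorm A w := by
  rw [wordNorm, euclideanMap_wordMatrix_append]
  exact norm_mul_le _ _

theorem wordNorm_singleton (k : I) : wordNorm A [k] = ‖euclideanMap (A k)‖ := by
  simp [wordNorm, wordMatrix]

theorem wordNorm_le_pow {q : ℝ} (hq : 0 ≤ q) (hA : ∀ k, ‖euclideanMap (A k)‖ ≤ q) (w : List I) :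
    wordNorm A w ≤ q ^ w.length := by
  induction w with
  | nil => 
    have h : ‖(1 : EuclideanSpace ℝ (Fin d) →L[ℝ] EuclideanSpace ℝ (Fin d))‖ ≤ 1 :=
      ContinuousLinearMap.norm_id_le
    simpa only [wordNorm, wordMatrix, euclideanMap, List.map_nil, List.prod_nil, map_one,
      List.length_nil, pow_zero] using h
  | cons k w ih =>
    rw [← List.singleton_append, List.length_append, pow_add]
    refine (wordNorm_append_le _ _).trans ?_
    gcongr
    · exact wordNorm_nonneg _
    · simpa [wordNorm_singleton] using hA k

theorem exists_wordNorm_le_pow [Finite I] (hA : ∀ k, ‖euclideanMap (A k)‖ < 1) :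
    ∃ q : ℝ, 0 < q ∧ q < 1 ∧ ∀ w, wordNorm A w ≤ q ^ w.length := by
  obtain ⟨q, h0, h1, h⟩ : ∃ q : ℝ, 0 < q ∧ q < 1 ∧ ∀ k, ‖euclideanMap (A k)‖ ≤ q := by
    rcases isEmpty_or_nonempty I with _ | _
    · exact ⟨1 / 2, by norm_num, by norm_num, fun k => isEmptyElim k⟩
    · obtain ⟨m, hm⟩ := Finite.exists_max fun k => ‖euclideanMap (A k)‖
      exact ⟨max (1 / 2) ‖euclideanMap (A m)‖, by positivity, max_lt (by norm_num) (hA m),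
        fun k => (hm k).trans (le_max_right _ _)⟩
  exact ⟨q, h0, h1, wordNorm_le_pow h0.le h⟩

/-- Removing the last letter of a word increases the norm by at most a constant factor. -/
theorem exists_wordNorm_le_mul_wordNorm_append [Finite I] (hA : ∀ k, IsUnit (A k)) :
    ∃ C : ℝ, 1 ≤ C ∧ ∀ w k, wordNorm A w ≤ C * wordNorm A (w ++ [k]) := by
  have key : ∀ k w, wordNorm A w ≤ ‖euclideanMap (A k)⁻¹‖ * wordNorm A (w ++ [k]) := fun k w => by
    have : euclideanMap (wordMatrix A w) =
        euclideanMap (wordMatrix A (w ++ [k])) * euclideanMap (A k)⁻¹ := by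
      have hdet := (Matrix.isUnit_iff_isUnit_det _).1 (hA k)
      rw [euclideanMap, euclideanMap, euclideanMap, ← map_mul]
      simp [wordMatrix, Matrix.mul_assoc, Matrix.mul_nonsing_inv _ hdet]
    rw [wordNorm, this, mul_comm]
    exact norm_mul_le _ _
  rcases isEmpty_or_nonempty I with _ | _
  · exact ⟨1, le_rfl, fun w k => isEmptyElim k⟩
  · obtain ⟨m, hm⟩ := Finite.exists_max fun k => ‖euclideanMap (A k)⁻¹‖
    refine ⟨max 1 ‖euclideanMap (A m)⁻¹‖, le_max_left _ _, fun w k => (key k w).trans ?_⟩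
    gcongr
    · exact wordNorm_nonneg _
    · exact (hm k).trans (le_max_right _ _)

theorem wordNorm_nil (hd : 1 ≤ d) : wordNorm A [] = 1 := by
  have : NeZero d := ⟨by omega⟩
  simp [wordNorm, wordMatrix, euclideanMap]

/-- Letters are removed one at a time down to the empty word. This at most exponential decay bounds
`(1/n) log S_n` below, as Fekete's lemma requires. -/
theorem wordNorm_lower_bound [Finite I] (hd : 1 ≤ d) (hA : ∀ k, IsUnit (A k)) :
    ∃ C : ℝ, 1 ≤ C ∧ ∀ w, 1 ≤ C ^ w.length * wordNorm A w := by
  obtain ⟨C, hC, h⟩ := exists_wordNorm_le_mul_wordNorm_append hA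
  refine ⟨C, hC, fun w => ?_⟩
  induction w using List.reverseRecOn with
  | nil => simp [wordNorm_nil hd]
  | append_singleton w k ih =>
    refine ih.trans ?_
    rw [List.length_append, pow_add, mul_assoc]
    simpa using mul_le_mul_of_nonneg_left (h w k) (by positivity : 0 ≤ C ^ w.length)

/-! ### The projection -/

theorem summable_projection [Finite I] (hA : ∀ k, ‖euclideanMap (A k)‖ < 1)
    (a : I → EuclideanSpace ℝ (Fin d)) :
    ∃ R : ℝ, 0 < R ∧ ∀ i : ℕ → I,
      Summable (fun n => euclideanMap (wordMatrix A (initialWord i n)) (a (i n))) ∧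
        ‖projection A a i‖ ≤ R := by
  obtain ⟨q, hq0, hq1, hq⟩ := exists_wordNorm_le_pow hA
  obtain ⟨M, hM⟩ : ∃ M, ∀ k, ‖a k‖ ≤ M := by
    obtain ⟨M, hM⟩ := (Set.finite_range fun k => ‖a k‖).bddAbove
    exact ⟨M, fun k => hM ⟨k, rfl⟩⟩
  have hb : ∀ (i : ℕ → I) n,
      ‖euclideanMap (wordMatrix A (initialWord i n)) (a (i n))‖ ≤ q ^ n * max M 1 := fun i n => by
    refine (ContinuousLinearMap.le_opNorm _ _).trans ?_
    gcongr
    · simpa [wordNorm] using hq (initialWord i n)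
    · exact (hM _).trans (le_max_left _ _)
  have hs : Summable fun n : ℕ => q ^ n * max M 1 :=
    (summable_geometric_of_lt_one hq0.le hq1).mul_right _
  refine ⟨∑' n : ℕ, q ^ n * max M 1, hs.tsum_pos (fun n => by positivity) 0 (by positivity),
    fun i => ⟨.of_norm_bounded hs (hb i), tsum_of_norm_bounded hs.hasSum (hb i)⟩⟩

theorem projection_eq_add [Finite I] (hA : ∀ k, ‖euclideanMap (A k)‖ < 1)
    (a : I → EuclideanSpace ℝ (Fin d)) (i : ℕ → I) (n : ℕ) :
    projection A a i =
      ∑ m ∈ Finset.range n, euclideanMap (wordMatrix A (initialWord i m)) (a (i m)) +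
        euclideanMap (wordMatrix A (initialWord i n)) (projection A a (shift^[n] i)) := by
  obtain ⟨R, -, hR⟩ := summable_projection hA a
  rw [projection, ← (hR i).1.sum_add_tsum_nat_add n, projection,
    ContinuousLinearMap.map_tsum _ (hR _).1]
  congr 1
  refine tsum_congr fun m => ?_
  rw [add_comm m n, initialWord_add, euclideanMap_wordMatrix_append, iterate_shift, add_comm n m]
  rfl

/-- The first `|w|` terms of the two series agree and cancel, so `E_w` is a translate of the image
of the whole self-affine set under `A_w`. -/
theorem projection_sub_projection [Finite I] (hA : ∀ k, ‖euclideanMap (A k)‖ < 1)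
    (a : I → EuclideanSpace ℝ (Fin d)) {w : List I} {i j : ℕ → I}
    (hi : i ∈ cylinder w) (hj : j ∈ cylinder w) :
    projection A a i - projection A a j = euclideanMap (wordMatrix A w)
      (projection A a (shift^[w.length] i) - projection A a (shift^[w.length] j)) := by
  have hij : ∀ m < w.length, i m = j m ∧ initialWord i m = initialWord j m := by
    have h0 : ∀ m < w.length, i m = j m := fun m hm => by
      have h : initialWord i w.length = initialWord j w.length := Eq.trans hi (Eq.symm hj)
      simpa [initialWord] using List.getElem_of_eq h (i := m) (by simpa using hm)
    refine fun m hm => ⟨h0 m hm, ?_⟩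
    refine List.ext_getElem (by simp) fun n h1 h2 => ?_
    simp only [length_initialWord] at h1
    simpa [initialWord] using h0 n (h1.trans hm)
  rw [projection_eq_add hA a i w.length, projection_eq_add hA a j w.length,
    show initialWord i w.length = w from hi, show initialWord j w.length = w from hj,
    Finset.sum_congr rfl fun m hm => by
      rw [(hij m (Finset.mem_range.1 hm)).1, (hij m (Finset.mem_range.1 hm)).2], map_sub]
  abel

end

section
variable {I : Type*} [Finite I] {d : ℕ} {A : I → Matrix (Fin d) (Fin d) ℝ} {K : Set (ℕ → I)}
  {t : ℝ}

/-! ### The pressure -/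

/-- The sum `∑_{w ∈ K_n} ‖A_w‖^t`. -/
def levelSum (A : I → Matrix (Fin d) (Fin d) ℝ) (K : Set (ℕ → I)) (t : ℝ) (n : ℕ) : ℝ :=
  ∑ w ∈ (levelWords_finite K n).toFinset, wordNorm A w ^ t

theorem levelSum_nonneg (n : ℕ) : 0 ≤ levelSum A K t n :=
  Finset.sum_nonneg fun _ _ => Real.rpow_nonneg (wordNorm_nonneg _) _

/-- If every element of `K` begins with a word of `W`, then decomposing the words of `K_n` at their
prefixes in `W` bounds the `n`-th level sum by earlier ones. -/
theorem levelSum_le_of_cover (hK : shift '' K ⊆ K) (ht : 0 ≤ t) (W : Finset (List I))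
    (hW : ∀ i ∈ K, ∃ w ∈ W, i ∈ cylinder w) {n : ℕ} (hn : ∀ w ∈ W, w.length ≤ n) :
    levelSum A K t n ≤ ∑ w ∈ W, wordNorm A w ^ t * levelSum A K t (n - w.length) := by
  classical
  set D : ℕ → Finset (List I) := fun m => (levelWords_finite K m).toFinset with hD
  have hmem : ∀ {m v}, v ∈ D m ↔ v ∈ levelWords K m := Set.Finite.mem_toFinset _
  set T : Finset (List I × List I) := W.biUnion fun w => (D (n - w.length)).image (Prod.mk w)
  -- Words of `W` may be prefixes of one another, so one decomposition of each `v` is chosen.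
  -- Concatenation recovers `v`, which makes the choice injective; the pair of empty words is a
  -- dummy value off `K_n`.
  have hdec : ∀ v, ∃ p : List I × List I, v ∈ D n → p ∈ T ∧ p.1 ++ p.2 = v := by
    intro v
    by_cases hv : v ∈ D n
    · obtain ⟨i, hi, rfl⟩ := hmem.1 hv
      obtain ⟨w, hw, hiw⟩ := hW i hi
      refine ⟨⟨w, initialWord (shift^[w.length] i) (n - w.length)⟩, fun _ => ⟨?_, ?_⟩⟩
      · exact Finset.mem_biUnion.2 ⟨w, hw, Finset.mem_image_of_mem _
          (hmem.2 ⟨_, iterate_shift_mem hK hi _, rfl⟩)⟩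
      · have h1 : initialWord i w.length = w := hiw
        have h2 := initialWord_add i w.length (n - w.length)
        rw [Nat.add_sub_cancel' (hn w hw), h1] at h2
        exact h2.symm
    · exact ⟨([], []), fun h => absurd h hv⟩
  choose g hg using hdec
  have hinj : Set.InjOn g (D n) := fun u hu v hv h => by
    rw [← (hg u hu).2, ← (hg v hv).2, h]
  have hnn : ∀ w, 0 ≤ wordNorm A w ^ t := fun w => Real.rpow_nonneg (wordNorm_nonneg _) _
  calc levelSum A K t n
      = ∑ v ∈ D n, wordNorm A ((g v).1 ++ (g v).2) ^ t :=
        Finset.sum_congr rfl fun v hv => (congrArg (fun u => wordNorm A u ^ t) (hg v hv).2).symm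
    _ = ∑ p ∈ (D n).image g, wordNorm A (p.1 ++ p.2) ^ t :=
        by rw [Finset.sum_image hinj]
    _ ≤ ∑ p ∈ T, wordNorm A (p.1 ++ p.2) ^ t :=
        Finset.sum_le_sum_of_subset_of_nonneg
          (Finset.image_subset_iff.2 fun v hv => (hg v hv).1) fun p _ _ => hnn _
    _ ≤ ∑ p ∈ T, wordNorm A p.1 ^ t * wordNorm A p.2 ^ t := by
        refine Finset.sum_le_sum fun p _ => ?_
        rw [← Real.mul_rpow (wordNorm_nonneg _) (wordNorm_nonneg _)]
        exact Real.rpow_le_rpow (wordNorm_nonneg _) (wordNorm_append_le _ _) ht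
    _ = ∑ w ∈ W, ∑ u ∈ D (n - w.length), wordNorm A w ^ t * wordNorm A u ^ t := by
        rw [Finset.sum_biUnion]
        · exact Finset.sum_congr rfl fun w _ =>
            Finset.sum_image fun u _ v _ h => (Prod.mk.inj h).2
        · intro w _ w' _ hne
          refine Finset.disjoint_left.2 fun p hp hp' => hne ?_
          obtain ⟨u, -, rfl⟩ := Finset.mem_image.1 hp
          obtain ⟨u', -, h⟩ := Finset.mem_image.1 hp'
          exact (Prod.mk.inj h).1.symm
    _ = _ := Finset.sum_congr rfl fun w _ => (Finset.mul_sum _ _ _).symm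

theorem levelSum_add_le (hK : shift '' K ⊆ K) (ht : 0 ≤ t) (m n : ℕ) :
    levelSum A K t (m + n) ≤ levelSum A K t m * levelSum A K t n := by
  have hlen : ∀ w ∈ (levelWords_finite K m).toFinset, w.length = m := fun w hw => by
    obtain ⟨i, -, rfl⟩ := (Set.Finite.mem_toFinset _).1 hw
    simp
  refine (levelSum_le_of_cover hK ht (levelWords_finite K m).toFinset (fun i hi =>
    ⟨initialWord i m, (Set.Finite.mem_toFinset _).2 ⟨i, hi, rfl⟩, mem_cylinder_initialWord i m⟩)
    fun w hw => (hlen w hw).le.trans (Nat.le_add_right _ _)).trans_eq ?_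
  rw [levelSum, Finset.sum_mul]
  exact Finset.sum_congr rfl fun w hw => by rw [hlen w hw, Nat.add_sub_cancel_left]

theorem exists_le_levelSum (hd : 1 ≤ d) (hA : ∀ k, IsUnit (A k)) (hK_ne : K.Nonempty)
    (ht : 0 ≤ t) : ∃ c : ℝ, 0 < c ∧ c ≤ 1 ∧ ∀ n, c ^ n ≤ levelSum A K t n := by
  obtain ⟨C, hC, h⟩ := wordNorm_lower_bound hd hA
  obtain ⟨i, hi⟩ := hK_ne
  refine ⟨C⁻¹ ^ t, by positivity, Real.rpow_le_one (by positivity) (inv_le_one_of_one_le₀ hC) ht,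
    fun n => ?_⟩
  have h1 : C⁻¹ ^ n ≤ wordNorm A (initialWord i n) := by
    have := h (initialWord i n)
    rw [length_initialWord] at this
    rw [inv_pow]
    exact (inv_le_iff_one_le_mul₀' (by positivity)).2 this
  calc (C⁻¹ ^ t) ^ n = (C⁻¹ ^ n) ^ t := by
        rw [← Real.rpow_natCast, ← Real.rpow_natCast, ← Real.rpow_mul (by positivity),
          ← Real.rpow_mul (by positivity), mul_comm]
    _ ≤ wordNorm A (initialWord i n) ^ t := Real.rpow_le_rpow (by positivity) h1 ht
    _ ≤ levelSum A K t n := Finset.single_le_sum (f := fun w => wordNorm A w ^ t)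
        (fun _ _ => Real.rpow_nonneg (wordNorm_nonneg _) _)
        ((Set.Finite.mem_toFinset _).2 ⟨i, hi, rfl⟩)

/-- When the pressure vanishes at `s ≤ 1`, all level sums are at least `1`, and they grow
subexponentially. -/
theorem levelSum_of_pressure_eq_zero (hd : 1 ≤ d) (hA : ∀ k, IsUnit (A k)) (hK_ne : K.Nonempty)
    (hK : shift '' K ⊆ K) {s : ℝ} (hs0 : 0 < s) (hs1 : s ≤ 1) (hP : pressure A K s = 0) :
    (∀ n, 1 ≤ n → 1 ≤ levelSum A K s n) ∧
      ∀ ε > 0, ∀ᶠ n : ℕ in atTop, levelSum A K s n ≤ Real.exp (n * ε) := by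
  obtain ⟨c, hc0, hc1, hc⟩ := exists_le_levelSum hd hA hK_ne hs0.le
  have hpos : ∀ n, 0 < levelSum A K s n := fun n => (pow_pos hc0 n).trans_le (hc n)
  have hsub : Subadditive fun n => Real.log (levelSum A K s n) := fun m n => by
    rw [← Real.log_mul (hpos m).ne' (hpos n).ne']
    exact Real.log_le_log (hpos _) (levelSum_add_le hK hs0.le m n)
  have hbdd : BddBelow (Set.range fun n : ℕ => Real.log (levelSum A K s n) / n) := by
    refine ⟨Real.log c, ?_⟩
    rintro _ ⟨n, rfl⟩
    rcases n.eq_zero_or_pos with rfl | hn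
    -- The term at `n = 0` is a division by zero, hence `0`; this is why `c ≤ 1` is required.
    · simpa using Real.log_nonpos hc0.le hc1
    · have hn' : (0 : ℝ) < n := by exact_mod_cast hn
      rw [le_div_iff₀ hn', mul_comm, ← Real.log_pow]
      exact Real.log_le_log (by positivity) (hc n)
  have hlim := hsub.tendsto_lim hbdd
  have hzero : hsub.lim = 0 := by
    rw [← hP, pressure]
    refine (Tendsto.limUnder_eq (hlim.congr fun n => ?_)).symm
    rw [div_eq_inv_mul, one_div, levelSum]
    simp_rw [singularValueFunction_eq_norm_rpow hd hs0 hs1]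
    rfl
  constructor
  · intro n hn
    -- The Fekete limit is an infimum, so its vanishing bounds every single term, not only the
    -- asymptotics.
    have h := hsub.lim_le_div hbdd (n := n) (by omega)
    have hn' : (0 : ℝ) < n := by exact_mod_cast hn
    rw [hzero, le_div_iff₀ hn', zero_mul] at h
    exact (Real.log_nonneg_iff (hpos n)).1 h
  · intro ε hε
    rw [hzero] at hlim
    filter_upwards [hlim.eventually_lt_const hε, eventually_gt_atTop 0] with n h hn
    have hn' : (0 : ℝ) < n := by exact_mod_cast hn
    rw [div_lt_iff₀ hn', mul_comm] at h
    exact ((Real.log_lt_iff_lt_exp (hpos n)).1 h).le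

/-- A finite cover of `K` by cylinders of nonempty words has total weight at least `1`. -/
theorem one_le_sum_of_cover (hK : shift '' K ⊆ K) (ht : 0 ≤ t)
    (hS : ∀ n, 1 ≤ n → 1 ≤ levelSum A K t n) (W : Finset (List I)) (hnil : [] ∉ W)
    (hW : ∀ i ∈ K, ∃ w ∈ W, i ∈ cylinder w) : 1 ≤ ∑ w ∈ W, wordNorm A w ^ t := by
  by_contra! hlt
  set ρ := ∑ w ∈ W, wordNorm A w ^ t with hρ
  have hρ0 : 0 ≤ ρ := Finset.sum_nonneg fun _ _ => Real.rpow_nonneg (wordNorm_nonneg _) _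
  -- The extra `1` keeps `L` positive, so that `k * L ≥ 1` at the end.
  set L := W.sup List.length + 1 with hL
  have hlen : ∀ w ∈ W, 1 ≤ w.length ∧ w.length ≤ L := fun w hw => by
    refine ⟨List.length_pos_iff.2 fun h => hnil (h ▸ hw), ?_⟩
    have := Finset.le_sup (f := List.length) hw
    omega
  have step : ∀ n B, L ≤ n → (∀ w ∈ W, levelSum A K t (n - w.length) ≤ B) →
      levelSum A K t n ≤ ρ * B := fun n B hn hB => by
    refine (levelSum_le_of_cover hK ht W hW fun w hw => (hlen w hw).2.trans hn).trans ?_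
    rw [hρ, Finset.sum_mul]
    exact Finset.sum_le_sum fun w hw =>
      mul_le_mul_of_nonneg_left (hB w hw) (Real.rpow_nonneg (wordNorm_nonneg _) _)
  set M := ∑ m ∈ Finset.range L, levelSum A K t m
  have hM0 : 0 ≤ M := Finset.sum_nonneg fun _ _ => levelSum_nonneg _
  -- The recursion descends because words of `W` are nonempty, and `ρ ≤ 1` preserves the bound.
  have hM : ∀ n, levelSum A K t n ≤ M := fun n => by
    induction n using Nat.strong_induction_on with
    | _ n ih =>
      rcases lt_or_ge n L with h | h
      · exact Finset.single_le_sum (f := fun m => levelSum A K t m)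
          (fun _ _ => levelSum_nonneg _) (Finset.mem_range.2 h)
      · refine (step n M h fun w hw => ih _ ?_).trans (mul_le_of_le_one_left hM0 hlt.le)
        have := hlen w hw
        omega
  -- Each cut uses at most `L` letters and gains a factor `ρ`.
  have hdecay : ∀ k n, k * L ≤ n → levelSum A K t n ≤ ρ ^ k * M := fun k => by
    induction k with
    | zero => intro n _; simpa using hM n
    | succ k ih =>
      intro n hn
      rw [add_mul, one_mul] at hn
      rw [pow_succ', mul_assoc]
      refine step n _ (by omega) fun w hw => ih _ ?_
      have := hlen w hw
      omega
  have h0 : Tendsto (fun k => ρ ^ k * M) atTop (𝓝 0) := by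
    simpa using (tendsto_pow_atTop_nhds_zero_of_lt_one hρ0 hlt).mul_const M
  obtain ⟨k, hk, hk1⟩ :=
    ((h0.eventually_lt_const one_pos).and (eventually_ge_atTop 1)).exists
  have := hS (k * L) (Nat.mul_pos hk1 (Nat.succ_pos _))
  linarith [hdecay k _ le_rfl]

/-- A countable cover of a compact `K` by cylinders of nonempty words has total weight at
least `1`. -/
theorem one_le_tsum_of_cover [TopologicalSpace I] [DiscreteTopology I] (hKc : IsCompact K)
    (hK : shift '' K ⊆ K) (ht : 0 ≤ t) (hS : ∀ n, 1 ≤ n → 1 ≤ levelSum A K t n)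
    (W : Set (List I)) (hnil : [] ∉ W) (hW : K ⊆ ⋃ w ∈ W, cylinder w) :
    1 ≤ ∑' w : W, ENNReal.ofReal (wordNorm A w ^ t) := by
  obtain ⟨F, hFW, hF, hKF⟩ := hKc.elim_finite_subcover_image
    (fun w _ => isOpen_cylinder w) hW
  lift F to Finset (List I) using hF
  have h1 := one_le_sum_of_cover (A := A) hK ht hS F (fun h => hnil (hFW h)) fun i hi => by
    simpa using hKF hi
  calc (1 : ℝ≥0∞) ≤ ENNReal.ofReal (∑ w ∈ F, wordNorm A w ^ t) := by
        simpa using ENNReal.ofReal_le_ofReal h1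
    _ = ∑ w ∈ F, ENNReal.ofReal (wordNorm A w ^ t) :=
        ENNReal.ofReal_sum_of_nonneg fun _ _ => Real.rpow_nonneg (wordNorm_nonneg _) _
    _ = ∑' w : (F : Set (List I)), ENNReal.ofReal (wordNorm A w ^ t) :=
        (Finset.tsum_subtype' F fun w => ENNReal.ofReal (wordNorm A w ^ t)).symm
    _ ≤ _ := ENNReal.tsum_mono_subtype (fun w => ENNReal.ofReal (wordNorm A w ^ t)) hFW

end

/-! ### Operators on a spanning set, and a packing bound -/

/-- A continuous linear operator on `ℝ^d` is controlled by its values on a spanning set. -/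
theorem exists_opNorm_le_of_span_eq_top {d : ℕ} {S : Set (EuclideanSpace ℝ (Fin d))}
    (hS : Submodule.span ℝ S = ⊤) :
    ∃ C : ℝ, 0 < C ∧ ∀ (B : EuclideanSpace ℝ (Fin d) →L[ℝ] EuclideanSpace ℝ (Fin d)) (D : ℝ),
      0 ≤ D → (∀ z ∈ S, ‖B z‖ ≤ D) → ‖B‖ ≤ C * D := by
  -- Each vector of the span gets its own constant, independent of `B`; afterwards only the `d`
  -- basis vectors are used.
  have key : ∀ u ∈ Submodule.span ℝ S, ∃ C : ℝ, 0 ≤ C ∧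
      ∀ (B : EuclideanSpace ℝ (Fin d) →L[ℝ] EuclideanSpace ℝ (Fin d)) (D : ℝ),
        0 ≤ D → (∀ z ∈ S, ‖B z‖ ≤ D) → ‖B u‖ ≤ C * D := by
    intro u hu
    induction hu using Submodule.span_induction with
    | mem z hz => exact ⟨1, zero_le_one, fun B D _ h => by simpa using h z hz⟩
    | zero => exact ⟨0, le_rfl, fun B D _ _ => by simp⟩
    | add x y _ _ hx hy =>
      obtain ⟨C, hC, hx⟩ := hx
      obtain ⟨C', hC', hy⟩ := hy
      refine ⟨C + C', by positivity, fun B D hD h => ?_⟩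
      rw [map_add, add_mul]
      exact (norm_add_le _ _).trans (add_le_add (hx B D hD h) (hy B D hD h))
    | smul c x _ hx =>
      obtain ⟨C, hC, hx⟩ := hx
      refine ⟨‖c‖ * C, by positivity, fun B D hD h => ?_⟩
      rw [map_smul, norm_smul, mul_assoc]
      exact mul_le_mul_of_nonneg_left (hx B D hD h) (norm_nonneg _)
  choose C hC hCB using fun k : Fin d =>
    key (EuclideanSpace.basisFun (Fin d) ℝ k) (hS ▸ Submodule.mem_top)
  -- Adding `1` makes the constant positive even when all the `C k` vanish.
  refine ⟨∑ k, C k + 1, by have := Finset.sum_nonneg fun k (_ : k ∈ Finset.univ) => hC k; linarith,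
    fun B D hD h => ?_⟩
  have h0 : 0 ≤ ∑ k, C k := Finset.sum_nonneg fun k _ => hC k
  refine B.opNorm_le_bound (by positivity) fun x => ?_
  conv_lhs => rw [← (EuclideanSpace.basisFun (Fin d) ℝ).sum_repr x, map_sum]
  calc ‖∑ k, B ((EuclideanSpace.basisFun (Fin d) ℝ).repr x k • EuclideanSpace.basisFun (Fin d) ℝ k)‖
      ≤ ∑ k, ‖x‖ * (C k * D) := by
        refine norm_sum_le_of_le _ fun k _ => ?_
        rw [map_smul, norm_smul]
        have hx : ‖(EuclideanSpace.basisFun (Fin d) ℝ).repr x k‖ ≤ ‖x‖ := by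
          simpa using PiLp.norm_apply_le x k
        exact mul_le_mul hx (hCB k B D hD h) (norm_nonneg _) (norm_nonneg _)
    _ = (∑ k, C k) * D * ‖x‖ := by rw [← Finset.mul_sum, ← Finset.sum_mul, mul_comm]
    _ ≤ (∑ k, C k + 1) * D * ‖x‖ := by gcongr; linarith

/-- The number of disjoint balls of radius `δ r` centred in a ball of radius `2 r` is bounded. -/
theorem exists_encard_le_of_pairwiseDisjoint_closedBall {E ι : Type*} [NormedAddCommGroup E]
    [NormedSpace ℝ E] [ProperSpace E] {δ : ℝ} (hδ : 0 < δ) :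
    ∃ N : ℕ, ∀ (x : E) (r : ℝ), 0 < r → ∀ (Z : Set ι) (p : ι → E),
      (∀ z ∈ Z, p z ∈ closedBall x (2 * r)) →
      (Z.PairwiseDisjoint fun z => closedBall (p z) (δ * r)) → Z.encard ≤ N := by
  obtain ⟨T, -, hT, hcov⟩ := (isCompact_closedBall (0 : E) 2).finite_cover_balls hδ
  refine ⟨T.ncard, fun x r hr Z p hp hdisj => ?_⟩
  -- `T` is a finite `δ`-net of the ball of radius `2`. After rescaling, every ball of the packing
  -- contains a net point, and disjoint balls contain distinct ones.
  have hex : ∀ z, ∃ y, z ∈ Z → y ∈ T ∧ x + r • y ∈ closedBall (p z) (δ * r) := by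
    intro z
    by_cases hz : z ∈ Z
    · have h1 : r⁻¹ • (p z - x) ∈ closedBall (0 : E) 2 := by
        have := hp z hz
        rw [mem_closedBall, dist_eq_norm] at this
        rw [mem_closedBall_zero_iff, norm_smul, norm_inv, Real.norm_of_nonneg hr.le,
          inv_mul_le_iff₀ hr]
        linarith
      obtain ⟨y, hy, hzy⟩ := Set.mem_iUnion₂.1 (hcov h1)
      refine ⟨y, fun _ => ⟨hy, ?_⟩⟩
      rw [mem_ball, dist_comm, dist_eq_norm] at hzy
      have h2 : x + r • y - p z = r • (y - r⁻¹ • (p z - x)) := by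
        rw [smul_sub, smul_inv_smul₀ hr.ne']; abel
      rw [mem_closedBall, dist_eq_norm, h2, norm_smul, Real.norm_of_nonneg hr.le, mul_comm]
      gcongr
    · exact ⟨0, fun h => absurd h hz⟩
  choose f hf using hex
  rw [hT.cast_ncard_eq]
  refine Set.encard_le_encard_of_injOn (f := f) (fun z hz => (hf z hz).1) fun z hz z' hz' h => ?_
  by_contra hne
  exact Set.disjoint_left.1 (hdisj hz hz' hne) (hf z hz).2 (h ▸ (hf z' hz').2)

/-! ### Diameters of cylinder sets -/

section
variable {I : Type*} {d : ℕ} {A : I → Matrix (Fin d) (Fin d) ℝ}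
  {a : I → EuclideanSpace ℝ (Fin d)} {K : Set (ℕ → I)}

/-- If `v` is orthogonal to all differences, `⟨v, ·⟩` is constant on `E_K`, which then lies in a
hyperplane. The pairs range over the whole symbol space because cylinders `[w]` are not restricted
to `K`. -/
theorem span_projection_sub_eq_top (hK_ne : K.Nonempty)
    (hE : ∀ v : EuclideanSpace ℝ (Fin d), v ≠ 0 → ∀ c : ℝ,
      ¬ limitSet A a K ⊆ {x | inner ℝ v x = c}) :
    Submodule.span ℝ (Set.range fun p : (ℕ → I) × (ℕ → I) =>
      projection A a p.1 - projection A a p.2) = ⊤ := by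
  rw [← Submodule.orthogonal_eq_bot_iff, Submodule.eq_bot_iff]
  intro v hv
  by_contra hne
  obtain ⟨j, hj⟩ := hK_ne
  refine hE v hne (inner ℝ v (projection A a j)) ?_
  rintro _ ⟨i, -, rfl⟩
  have h := (Submodule.mem_orthogonal' _ _).1 hv _ (Submodule.subset_span ⟨(i, j), rfl⟩)
  rw [inner_sub_right, sub_eq_zero] at h
  exact h

theorem nil_notMem_stoppingWordsAt (x : EuclideanSpace ℝ (Fin d)) (r : ℝ) :
    [] ∉ stoppingWordsAt A a K x r := by
  rintro ⟨⟨⟨n, hn, i, -, hi⟩, -⟩, -⟩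
  have : (initialWord i n).length = 0 := congrArg List.length hi
  rw [length_initialWord] at this
  omega

variable [Finite I]

/-- Cylinder sets have diameter at most a constant times the norm of the matrix. -/
theorem exists_dist_projection_le (hA : ∀ k, ‖euclideanMap (A k)‖ < 1)
    (a : I → EuclideanSpace ℝ (Fin d)) :
    ∃ R : ℝ, 0 < R ∧ ∀ w, ∀ i ∈ cylinder w, ∀ j ∈ cylinder w,
      dist (projection A a i) (projection A a j) ≤ R * wordNorm A w := by
  obtain ⟨R, hR0, hR⟩ := summable_projection hA a
  refine ⟨2 * R, by positivity, fun w i hi j hj => ?_⟩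
  rw [dist_eq_norm, projection_sub_projection hA a hi hj, mul_comm]
  refine (ContinuousLinearMap.le_opNorm _ _).trans ?_
  rw [wordNorm]
  gcongr
  refine (norm_sub_le _ _).trans ?_
  linarith [(hR (shift^[w.length] i)).2, (hR (shift^[w.length] j)).2]

theorem isBounded_cylinderSet (hA : ∀ k, ‖euclideanMap (A k)‖ < 1)
    (a : I → EuclideanSpace ℝ (Fin d)) (w : List I) :
    Bornology.IsBounded (cylinderSet A a w) := by
  obtain ⟨R, -, hR⟩ := exists_dist_projection_le hA a
  refine isBounded_iff.2 ⟨R * wordNorm A w, ?_⟩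
  rintro _ ⟨i, hi, rfl⟩ _ ⟨j, hj, rfl⟩
  exact hR w i hi j hj

/-- If `E_K` lies in no hyperplane, the norm of `A_w` is at most a constant times the diameter of
the cylinder set `E_w`. -/
theorem exists_wordNorm_le_diam (hA : ∀ k, ‖euclideanMap (A k)‖ < 1) (hK_ne : K.Nonempty)
    (hE : ∀ v : EuclideanSpace ℝ (Fin d), v ≠ 0 → ∀ c : ℝ,
      ¬ limitSet A a K ⊆ {x | inner ℝ v x = c}) :
    ∃ C : ℝ, 0 < C ∧ ∀ w, wordNorm A w ≤ C * diam (cylinderSet A a w) := by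
  obtain ⟨C, hC, h⟩ := exists_opNorm_le_of_span_eq_top (span_projection_sub_eq_top hK_ne hE)
  refine ⟨C, hC, fun w => h _ _ diam_nonneg ?_⟩
  rintro _ ⟨⟨i, j⟩, rfl⟩
  -- Every pair of symbols is the pair of tails of two elements of `[w]`, so `A_w` maps each
  -- spanning difference to a difference of points of `E_w`.
  obtain ⟨i', hi', rfl⟩ := exists_mem_cylinder_iterate_shift_eq w i
  obtain ⟨j', hj', rfl⟩ := exists_mem_cylinder_iterate_shift_eq w j
  simp only
  rw [← projection_sub_projection hA a hi' hj', ← dist_eq_norm]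
  exact dist_le_diam_of_mem (isBounded_cylinderSet hA a w) ⟨i', hi', rfl⟩ ⟨j', hj', rfl⟩

theorem tendsto_wordNorm_initialWord (hA : ∀ k, ‖euclideanMap (A k)‖ < 1) (i : ℕ → I) :
    Tendsto (fun n => wordNorm A (initialWord i n)) atTop (𝓝 0) := by
  obtain ⟨q, hq0, hq1, hq⟩ := exists_wordNorm_le_pow hA
  refine squeeze_zero (fun n => wordNorm_nonneg _) (fun n => ?_)
    (tendsto_pow_atTop_nhds_zero_of_lt_one hq0.le hq1)
  simpa using hq (initialWord i n)

/-! ### Stopping words -/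

/-- A quantity attached to the initial words of `i` that tends to zero crosses every level below
its initial value. -/
theorem exists_initialWord_crossing {I : Type*} {f : List I → ℝ} {i : ℕ → I} {r : ℝ} (hr : 0 < r)
    (h0 : r < f []) (hf : Tendsto (fun n => f (initialWord i n)) atTop (𝓝 0)) :
    ∃ n, f (initialWord i (n + 1)) ≤ r ∧ r < f (initialWord i n) := by
  classical
  have hex : ∃ n, f (initialWord i n) ≤ r := (hf.eventually_le_const hr).exists
  have hne : Nat.find hex ≠ 0 := fun h => by
    have := Nat.find_spec hex
    rw [h] at this
    exact absurd this (not_le.2 h0)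
  obtain ⟨n, hn⟩ := Nat.exists_eq_succ_of_ne_zero hne
  have hspec := Nat.find_spec hex
  rw [hn] at hspec
  exact ⟨n, hspec, not_le.1 (Nat.find_min hex (by omega))⟩

/-- The diameters of `E_{i|ₙ}` tend to zero; starting above `r` at the empty word ensures that the
stopping word has a last letter to drop. -/
theorem exists_mem_stoppingWordsAt (hA : ∀ k, ‖euclideanMap (A k)‖ < 1)
    {x : EuclideanSpace ℝ (Fin d)} {r : ℝ} (hr : 0 < r) (hr' : r < diam (cylinderSet A a []))
    {i : ℕ → I} (hi : i ∈ K) (hx : projection A a i ∈ closedBall x r) :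
    ∃ w ∈ stoppingWordsAt A a K x r, i ∈ cylinder w := by
  obtain ⟨R, hR0, hR⟩ := exists_dist_projection_le hA a
  have hlim : Tendsto (fun n => diam (cylinderSet A a (initialWord i n))) atTop (𝓝 0) := by
    refine squeeze_zero (fun n => diam_nonneg) (fun n => ?_)
      (by simpa using (tendsto_wordNorm_initialWord hA i).const_mul R)
    refine diam_le_of_forall_dist_le (mul_nonneg hR0.le (wordNorm_nonneg _)) ?_
    rintro _ ⟨i, hi, rfl⟩ _ ⟨j, hj, rfl⟩
    exact hR _ i hi j hj
  obtain ⟨n, hn, hn'⟩ := exists_initialWord_crossing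
    (f := fun w => diam (cylinderSet A a w)) hr hr' hlim
  refine ⟨initialWord i (n + 1), ⟨⟨⟨n + 1, by omega, i, hi, rfl⟩, hn, ?_⟩,
    projection A a i, ⟨i, mem_cylinder_initialWord i _, rfl⟩, hx⟩, mem_cylinder_initialWord i _⟩
  rwa [dropLast_initialWord_succ]

/-- Under the ball condition the number of stopping words at `x` is bounded at small scales, by a
constant that does not depend on `x`. -/
theorem BallCondition.exists_encard_le (hA : ∀ k, ‖euclideanMap (A k)‖ < 1)
    (h : BallCondition A a K) :
    ∃ N : ℕ, ∀ x ∈ limitSet A a K, ∃ r₀ : ℝ, 0 < r₀ ∧ ∀ r : ℝ, 0 < r → r < r₀ →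
      (stoppingWordsAt A a K x r).encard ≤ N := by
  obtain ⟨δ, hδ, -, h⟩ := h
  obtain ⟨N, hN⟩ := exists_encard_le_of_pairwiseDisjoint_closedBall
    (E := EuclideanSpace ℝ (Fin d)) (ι := List I) hδ
  refine ⟨N, fun x hx => ?_⟩
  obtain ⟨r₀, hr₀, h⟩ := h x hx
  refine ⟨r₀, hr₀, fun r hr hr' => ?_⟩
  obtain ⟨p, hp, hdisj⟩ := h r hr hr'
  refine hN x r hr _ p (fun w hw => ?_) hdisj
  -- `E_w` has diameter at most `r` and meets `B(x, r)`, so it lies in the convex ball `B(x, 2r)`,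
  -- and so does its hull.
  refine convexHull_min (fun y hy => ?_) (convex_closedBall x (2 * r)) (hp w hw)
  obtain ⟨⟨-, hd, -⟩, z, hz, hzx⟩ := hw
  have h1 := dist_le_diam_of_mem (isBounded_cylinderSet hA a w) hy hz
  rw [mem_closedBall] at hzx ⊢
  linarith [dist_triangle y z x]

end

open MeasureTheory MeasureTheory.Measure

/-! ### Hausdorff and Minkowski dimension -/

/-- An optimal cover by `N(ε)` balls of diameter at most `2ε` bounds the `t`-dimensional Hausdorff
measure by `liminf 2 ^ t N(ε) ε ^ t`, which is `0` for every `t` in the defining infimum. -/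
theorem dimH_le_upperMinkowskiDim {X : Type*} [EMetricSpace X] (S : Set X) :
    dimH S ≤ upperMinkowskiDim S := by
  borelize X
  refine le_iInf₂ fun t ht => dimH_le_of_hausdorffMeasure_ne_top ?_
  set g : ℝ≥0 → ℝ≥0∞ := fun ε =>
    ((externalCoveringNumber ε S : ℕ∞) : ℝ≥0∞) * (ε : ℝ≥0∞) ^ (t : ℝ) with hg
  have hlim : Tendsto g (𝓝[>] 0) (𝓝 0) :=
    tendsto_of_le_liminf_of_limsup_le bot_le ht.le
  have hC : ∀ ε : ℝ≥0, ∃ C : Set X, C.Finite ∧ (externalCoveringNumber ε S ≠ ⊤ →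
      IsCover ε S C ∧ C.encard = externalCoveringNumber ε S) := by
    intro ε
    by_cases h : externalCoveringNumber ε S = ⊤
    · exact ⟨∅, Set.finite_empty, fun h' => absurd h h'⟩
    · have : Nonempty {C : Set X // IsCover ε S C} := ⟨⟨S, by simp⟩⟩
      obtain ⟨⟨C, hC⟩, hCe⟩ :=
        ENat.exists_eq_iInf fun C : {C : Set X // IsCover ε S C} => (C : Set X).encard
      have hCe' : C.encard = externalCoveringNumber ε S := by
        rw [externalCoveringNumber, iInf_subtype']; exact hCe
      exact ⟨C, Set.encard_ne_top_iff.1 (hCe' ▸ h), fun _ => ⟨hC, hCe'⟩⟩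
  choose C hCfin hC using hC
  -- `N(ε) ε ^ t < 1` with `ε > 0` rules out an infinite covering number, so the dummy cover `∅` is
  -- eventually never used.
  have hev : ∀ᶠ ε in 𝓝[>] (0 : ℝ≥0),
      IsCover ε S (C ε) ∧ (C ε).encard = externalCoveringNumber ε S := by
    filter_upwards [hlim.eventually_lt_const one_pos, self_mem_nhdsWithin] with ε hε hε0
    refine hC ε fun htop => ?_
    have h1 : (ε : ℝ≥0∞) ^ (t : ℝ) ≠ 0 :=
      (ENNReal.rpow_pos (by exact_mod_cast hε0) ENNReal.coe_ne_top).ne'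
    simp [hg, htop, ENNReal.top_mul h1] at hε
  have : ∀ ε, Countable (C ε) := fun ε => (hCfin ε).countable.to_subtype
  have h2 : Tendsto (fun ε : ℝ≥0 => (2 : ℝ≥0∞) * ε) (𝓝[>] 0) (𝓝 0) := by
    have : Tendsto (fun ε : ℝ≥0 => ((2 * ε : ℝ≥0) : ℝ≥0∞)) (𝓝[>] 0) (𝓝 ((2 * 0 : ℝ≥0) : ℝ≥0∞)) :=
      ENNReal.tendsto_coe.2 ((continuous_const.mul continuous_id).tendsto 0 |>.mono_left
        nhdsWithin_le_nhds)
    simpa using this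
  have hle := hausdorffMeasure_le_liminf_tsum (ι := fun ε => C ε) (t : ℝ) S
    (l := 𝓝[>] (0 : ℝ≥0)) (fun ε => 2 * ε) h2 (fun ε x => closedEBall (x : X) ε)
    (Eventually.of_forall fun ε x => ediam_closedEBall_le) (by
      filter_upwards [hev] with ε hε x hx
      obtain ⟨y, hy, hxy⟩ := hε.1 hx
      exact Set.mem_iUnion.2 ⟨⟨y, hy⟩, hxy⟩)
  have hlim2 : Tendsto (fun ε => (2 : ℝ≥0∞) ^ (t : ℝ) * g ε) (𝓝[>] 0) (𝓝 0) := by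
    simpa using ENNReal.Tendsto.const_mul hlim
      (Or.inr (ENNReal.rpow_ne_top_of_nonneg t.coe_nonneg ENNReal.ofNat_ne_top))
  refine ne_top_of_le_ne_top ENNReal.zero_ne_top (hle.trans ?_)
  rw [← hlim2.liminf_eq]
  refine liminf_le_liminf ?_
  filter_upwards [hev] with ε hε
  calc ∑' x : C ε, ediam (closedEBall (x : X) ε) ^ (t : ℝ)
      ≤ ∑' _ : C ε, (2 * (ε : ℝ≥0∞)) ^ (t : ℝ) :=
        ENNReal.tsum_le_tsum fun x => ENNReal.rpow_le_rpow ediam_closedEBall_le t.coe_nonneg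
    _ = 2 ^ (t : ℝ) * g ε := by
        rw [ENNReal.tsum_set_const, hε.2, ENNReal.mul_rpow_of_nonneg _ _ t.coe_nonneg]
        ring

/-! ### Lower bound: from Hausdorff covers to cylinder covers -/

section
variable {I : Type*} {d : ℕ} {A : I → Matrix (Fin d) (Fin d) ℝ}
  {a : I → EuclideanSpace ℝ (Fin d)} {K : Set (ℕ → I)}

/-- The words of `Z(x, r)` have total weight at most a constant times `r ^ s`. -/
theorem tsum_stoppingWordsAt_le {C : ℝ} (hC : 0 < C)
    (hCA : ∀ w, wordNorm A w ≤ C * diam (cylinderSet A a w)) {s : ℝ} (hs : 0 ≤ s) {N : ℕ}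
    {x : EuclideanSpace ℝ (Fin d)} {r : ℝ} (hr : 0 < r)
    (hN : (stoppingWordsAt A a K x r).encard ≤ N) :
    ∑' w : stoppingWordsAt A a K x r, ENNReal.ofReal (wordNorm A w ^ s) ≤
      N * ENNReal.ofReal C ^ s * ENNReal.ofReal r ^ s := by
  calc ∑' w : stoppingWordsAt A a K x r, ENNReal.ofReal (wordNorm A w ^ s)
      ≤ ∑' _ : stoppingWordsAt A a K x r, ENNReal.ofReal C ^ s * ENNReal.ofReal r ^ s := by
        refine ENNReal.tsum_le_tsum fun w => ?_
        rw [← ENNReal.mul_rpow_of_nonneg _ _ hs, ← ENNReal.ofReal_mul hC.le,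
          ENNReal.ofReal_rpow_of_nonneg (by positivity) hs]
        refine ENNReal.ofReal_le_ofReal (Real.rpow_le_rpow (wordNorm_nonneg _) ?_ hs)
        exact (hCA w).trans (mul_le_mul_of_nonneg_left w.2.1.2.1 hC.le)
    _ ≤ _ := by
        rw [ENNReal.tsum_set_const, mul_assoc]
        gcongr
        exact_mod_cast ENat.toENNReal_le.2 hN

variable [Finite I]

/-- A subset of `E_K` that is null for the `s`-dimensional Hausdorff measure, and at whose points
the number of stopping words is uniformly bounded, has a preimage of content zero. -/
theorem exists_cover_of_hausdorffMeasure_eq_zero (hA : ∀ k, ‖euclideanMap (A k)‖ < 1)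
    {C : ℝ} (hC : 0 < C) (hCA : ∀ w, wordNorm A w ≤ C * diam (cylinderSet A a w))
    {s : ℝ} (hs0 : 0 < s) (hs1 : s ≤ 1) {N : ℕ} {F : Set (EuclideanSpace ℝ (Fin d))} {η : ℝ}
    (hη : 0 < η) (hη' : η ≤ diam (cylinderSet A a []))
    (hF : ∀ x ∈ F, ∀ r, 0 < r → r < η → (stoppingWordsAt A a K x r).encard ≤ N)
    (hF0 : μH[s] F = 0) {ε : ℝ≥0∞} (hε : ε ≠ 0) :
    ∃ W : Set (List I), [] ∉ W ∧ (∀ i ∈ K, projection A a i ∈ F → i ∈ ⋃ w ∈ W, cylinder w) ∧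
      ∑' w : W, ENNReal.ofReal (wordNorm A w ^ s) ≤ ε := by
  set c : ℝ≥0∞ := N * ENNReal.ofReal C ^ s with hc
  have hctop : c ≠ ⊤ := ENNReal.mul_ne_top (ENNReal.natCast_ne_top _)
    (ENNReal.rpow_ne_top_of_nonneg hs0.le ENNReal.ofReal_ne_top)
  obtain ⟨ε₁, hε₁, hcε⟩ := ENNReal.exists_nnreal_pos_mul_lt
    (ENNReal.add_ne_top.2 ⟨hctop, hctop⟩) hε
  have hε₁' : (ε₁ : ℝ≥0∞) ≠ 0 := by exact_mod_cast hε₁.ne'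
  obtain ⟨T, hFT, hTd, hTs⟩ : ∃ T : ℕ → Set (EuclideanSpace ℝ (Fin d)), F ⊆ ⋃ n, T n ∧
      (∀ n, ediam (T n) ≤ ENNReal.ofReal (η / 2)) ∧
      ∑' n, ⨆ _ : (T n).Nonempty, ediam (T n) ^ s < ε₁ := by
    rw [hausdorffMeasure_apply] at hF0
    have h1 := le_iSup₂ (f := fun (r : ℝ≥0∞) (_ : 0 < r) =>
      ⨅ (t : ℕ → Set (EuclideanSpace ℝ (Fin d))) (_ : F ⊆ ⋃ n, t n) (_ : ∀ n, ediam (t n) ≤ r),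
        ∑' n, ⨆ _ : (t n).Nonempty, ediam (t n) ^ s) (ENNReal.ofReal (η / 2))
        (ENNReal.ofReal_pos.2 (by positivity))
    have h2 := (h1.trans hF0.le).trans_lt (pos_iff_ne_zero.2 hε₁')
    simp only [iInf_lt_iff] at h2
    obtain ⟨T, h, h', h''⟩ := h2
    exact ⟨T, h, h', h''⟩
  obtain ⟨τ, hτ0, hτ⟩ := ENNReal.exists_pos_sum_of_countable hε₁' ℕ
  have hW : ∀ n, ∃ W : Set (List I), [] ∉ W ∧
      (∀ i ∈ K, projection A a i ∈ F ∩ T n → i ∈ ⋃ w ∈ W, cylinder w) ∧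
      ∑' w : W, ENNReal.ofReal (wordNorm A w ^ s) ≤
        c * ((⨆ _ : (T n).Nonempty, ediam (T n) ^ s) + τ n) := by
    intro n
    rcases Set.eq_empty_or_nonempty (F ∩ T n) with h | ⟨x, hxF, hxT⟩
    · exact ⟨∅, Set.notMem_empty _, fun i _ hi => absurd hi (h ▸ Set.notMem_empty _), by simp⟩
    have hτn : (0 : ℝ) < τ n := hτ0 n
    have hdtop : ediam (T n) ≠ ⊤ := ne_top_of_le_ne_top ENNReal.ofReal_ne_top (hTd n)
    -- `T n` may have diameter zero, so the radius is enlarged by `u > 0`. The cost `u ^ s ≤ τ n` is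
    -- summable, and `u ≤ η / 4` together with `diam (T n) ≤ η / 2` keeps `r < η`.
    set u : ℝ := min (η / 4) ((τ n : ℝ) ^ s⁻¹)
    have hu0 : 0 < u := lt_min (by positivity) (by positivity)
    have hus : ENNReal.ofReal u ^ s ≤ τ n := by
      rw [ENNReal.ofReal_rpow_of_nonneg hu0.le hs0.le, ← ENNReal.ofReal_coe_nnreal]
      refine ENNReal.ofReal_le_ofReal ?_
      calc u ^ s ≤ ((τ n : ℝ) ^ s⁻¹) ^ s :=
            Real.rpow_le_rpow hu0.le (min_le_right _ _) hs0.le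
        _ = τ n := Real.rpow_inv_rpow hτn.le hs0.ne'
    set r : ℝ := (ediam (T n)).toReal + u with hr
    have hdn : (0 : ℝ) ≤ (ediam (T n)).toReal := ENNReal.toReal_nonneg
    have hr0 : 0 < r := by positivity
    have hrη : r < η := by
      have h1 : (ediam (T n)).toReal ≤ η / 2 :=
        ENNReal.toReal_le_of_le_ofReal (by positivity) (hTd n)
      have h2 : u ≤ η / 4 := min_le_left _ _
      linarith
    have hrs : ENNReal.ofReal r ^ s ≤ (⨆ _ : (T n).Nonempty, ediam (T n) ^ s) + τ n := by
      rw [hr, ENNReal.ofReal_add hdn hu0.le, ENNReal.ofReal_toReal hdtop, iSup_pos ⟨x, hxT⟩]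
      -- Subadditivity of `x ↦ x ^ s`, valid because `s ≤ 1`.
      exact (ENNReal.rpow_add_le_add_rpow _ _ hs0.le hs1).trans (by gcongr)
    refine ⟨stoppingWordsAt A a K x r, nil_notMem_stoppingWordsAt x r, ?_, ?_⟩
    · rintro i hi ⟨-, hiT⟩
      have hdist : projection A a i ∈ closedBall x r := by
        have h1 : dist (projection A a i) x ≤ (ediam (T n)).toReal := by
          rw [dist_edist]
          exact ENNReal.toReal_mono hdtop (edist_le_ediam_of_mem hiT hxT)
        exact mem_closedBall.2 (by linarith)
      obtain ⟨w, hw, hiw⟩ :=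
        exists_mem_stoppingWordsAt hA hr0 (hrη.trans_le hη') hi hdist
      exact Set.mem_iUnion₂.2 ⟨w, hw, hiw⟩
    · exact (tsum_stoppingWordsAt_le hC hCA hs0.le hr0 (hF x hxF r hr0 hrη)).trans
        (mul_le_mul_right hrs _)
  choose W hWnil hWcov hWsum using hW
  refine ⟨⋃ n, W n, by simpa using hWnil, fun i hi hiF => ?_, ?_⟩
  · obtain ⟨n, hn⟩ := Set.mem_iUnion.1 (hFT hiF)
    obtain ⟨w, hw, hiw⟩ := Set.mem_iUnion₂.1 (hWcov n i hi ⟨hiF, hn⟩)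
    exact Set.mem_iUnion₂.2 ⟨w, Set.mem_iUnion.2 ⟨n, hw⟩, hiw⟩
  · calc ∑' w : ⋃ n, W n, ENNReal.ofReal (wordNorm A w ^ s)
        ≤ ∑' n, ∑' w : W n, ENNReal.ofReal (wordNorm A w ^ s) :=
          ENNReal.tsum_iUnion_le_tsum (fun w => ENNReal.ofReal (wordNorm A w ^ s)) W
      _ ≤ ∑' n, c * ((⨆ _ : (T n).Nonempty, ediam (T n) ^ s) + τ n) :=
          ENNReal.tsum_le_tsum hWsum
      _ = c * (∑' n, (⨆ _ : (T n).Nonempty, ediam (T n) ^ s) + ∑' n, (τ n : ℝ≥0∞)) := by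
          rw [ENNReal.tsum_mul_left, ENNReal.tsum_add]
      _ ≤ c * (ε₁ + ε₁) := by gcongr
      _ = ε₁ * (c + c) := by ring
      _ ≤ ε := hcε.le

/-- The lower bound for the Hausdorff dimension. -/
theorem ofReal_le_dimH_limitSet [TopologicalSpace I] [DiscreteTopology I] (hd : 1 ≤ d)
    (hA : ∀ k, ‖euclideanMap (A k)‖ < 1) (hK_ne : K.Nonempty) (hKc : IsCompact K)
    (hK : shift '' K ⊆ K)
    (hE : ∀ v : EuclideanSpace ℝ (Fin d), v ≠ 0 → ∀ c : ℝ,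
      ¬ limitSet A a K ⊆ {x | inner ℝ v x = c})
    (hball : BallCondition A a K) {s : ℝ} (hs0 : 0 < s) (hs1 : s ≤ 1)
    (hS : ∀ n, 1 ≤ n → 1 ≤ levelSum A K s n) :
    ENNReal.ofReal s ≤ dimH (limitSet A a K) := by
  by_contra! hlt
  have hnull : μH[s] (limitSet A a K) = 0 := by
    have := hausdorffMeasure_of_dimH_lt (d := s.toNNReal) hlt
    rwa [Real.coe_toNNReal s hs0.le] at this
  obtain ⟨C, hC, hCA⟩ := exists_wordNorm_le_diam hA hK_ne hE
  obtain ⟨N, hN⟩ := hball.exists_encard_le hA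
  have hdiam : 0 < diam (cylinderSet A a []) := by
    have := hCA []
    rw [wordNorm_nil hd] at this
    exact pos_of_mul_pos_right (zero_lt_one.trans_le this) hC.le
  -- The bound `N` is uniform but the threshold `r₀` depends on the point, so `E_K` is split into
  -- countably many pieces with threshold at least `1 / (n + 1)`. The weight budgets `ε n` sum to
  -- less than `1`.
  set F : ℕ → Set (EuclideanSpace ℝ (Fin d)) := fun n => {x ∈ limitSet A a K |
    ∀ r, 0 < r → r < 1 / ((n : ℝ) + 1) → (stoppingWordsAt A a K x r).encard ≤ N}
  obtain ⟨ε, hε0, hε⟩ := ENNReal.exists_pos_sum_of_countable' (one_ne_zero (α := ℝ≥0∞)) ℕ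
  have hW : ∀ n, ∃ W : Set (List I), [] ∉ W ∧
      (∀ i ∈ K, projection A a i ∈ F n → i ∈ ⋃ w ∈ W, cylinder w) ∧
      ∑' w : W, ENNReal.ofReal (wordNorm A w ^ s) ≤ ε n := fun n =>
    exists_cover_of_hausdorffMeasure_eq_zero hA hC hCA hs0 hs1
      (η := min (1 / ((n : ℝ) + 1)) (diam (cylinderSet A a []))) (lt_min (by positivity) hdiam)
      (min_le_right _ _)
      (fun x hx r hr hr' => hx.2 r hr (hr'.trans_le (min_le_left _ _)))
      (measure_mono_null (fun x hx => hx.1) hnull) (hε0 n).ne'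
  choose W hWnil hWcov hWsum using hW
  have hcov : K ⊆ ⋃ w ∈ ⋃ n, W n, cylinder w := by
    intro i hi
    obtain ⟨r₀, hr₀, h⟩ := hN _ ⟨i, hi, rfl⟩
    obtain ⟨n, hn⟩ := exists_nat_one_div_lt hr₀
    obtain ⟨w, hw, hiw⟩ := Set.mem_iUnion₂.1
      (hWcov n i hi ⟨⟨i, hi, rfl⟩, fun r hr hr' => h r hr (hr'.trans hn)⟩)
    exact Set.mem_iUnion₂.2 ⟨w, Set.mem_iUnion.2 ⟨n, hw⟩, hiw⟩
  have h1 := one_le_tsum_of_cover (A := A) hKc hK hs0.le hS (⋃ n, W n) (by simpa using hWnil) hcov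
  have h2 := ENNReal.tsum_iUnion_le_tsum (fun w => ENNReal.ofReal (wordNorm A w ^ s)) W
  exact absurd (h1.trans (h2.trans (ENNReal.tsum_le_tsum hWsum))) (not_le.2 hε)

end

/-! ### Upper bound: counting words stopped by norm -/

section
variable {I : Type*} [Finite I] {d : ℕ} {A : I → Matrix (Fin d) (Fin d) ℝ}
  {a : I → EuclideanSpace ℝ (Fin d)} {K : Set (ℕ → I)}

/-- If the level sums at `s` grow subexponentially, the sum of `‖A_w‖^u` over all words of `K`
converges for `u > s`. -/
theorem summable_levelSum (hA : ∀ k, ‖euclideanMap (A k)‖ < 1) {s u : ℝ} (hs : 0 < s)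
    (hsu : s < u) (hS : ∀ ε > 0, ∀ᶠ n : ℕ in atTop, levelSum A K s n ≤ Real.exp (n * ε)) :
    Summable (levelSum A K u) := by
  obtain ⟨q, hq0, hq1, hq⟩ := exists_wordNorm_le_pow hA
  have hlog : Real.log q < 0 := Real.log_neg hq0 hq1
  -- Half the decay rate: `q ^ (n (u - s)) = exp (-2εn)` beats the growth `exp (εn)` of `S_n` and
  -- leaves `exp (-εn)`.
  set ε := -((u - s) * Real.log q) / 2 with hε
  have hε0 : 0 < ε := by
    have := mul_neg_of_pos_of_neg (sub_pos.2 hsu) hlog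
    rw [hε]; linarith
  have hle : ∀ n, levelSum A K u n ≤ Real.exp (-(n * (2 * ε))) * levelSum A K s n := by
    intro n
    rw [levelSum, levelSum, Finset.mul_sum]
    refine Finset.sum_le_sum fun w hw => ?_
    have hlen : w.length = n := by
      obtain ⟨i, -, rfl⟩ := (Set.Finite.mem_toFinset _).1 hw
      simp
    have h1 : wordNorm A w ^ (u - s) ≤ Real.exp (-(n * (2 * ε))) := by
      refine (Real.rpow_le_rpow (wordNorm_nonneg _) (hq w) (sub_pos.2 hsu).le).trans_eq ?_
      rw [Real.rpow_def_of_pos (by positivity), Real.log_pow, hlen, hε]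
      congr 1; ring
    calc wordNorm A w ^ u = wordNorm A w ^ (u - s) * wordNorm A w ^ s := by
          rw [← Real.rpow_add_of_nonneg (wordNorm_nonneg _) (sub_pos.2 hsu).le hs.le,
            sub_add_cancel]
      _ ≤ _ := mul_le_mul_of_nonneg_right h1 (Real.rpow_nonneg (wordNorm_nonneg _) _)
  have hgeom : Summable fun n : ℕ => Real.exp (n * -ε) :=
    Real.summable_exp_nat_mul_iff.2 (neg_lt_zero.2 hε0)
  refine summable_of_isBigO_nat hgeom (Asymptotics.IsBigO.of_bound 1 ?_)
  filter_upwards [hS ε hε0] with n hn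
  rw [Real.norm_of_nonneg (levelSum_nonneg n), Real.norm_of_nonneg (Real.exp_pos _).le, one_mul]
  refine (hle n).trans ((mul_le_mul_of_nonneg_left hn (Real.exp_pos _).le).trans_eq ?_)
  rw [← Real.exp_add]
  congr 1; ring

theorem tsum_words_ne_top {u : ℝ} (h : Summable (levelSum A K u)) :
    ∑' w : ⋃ n, levelWords K n, ENNReal.ofReal (wordNorm A w ^ u) ≠ ⊤ := by
  refine ne_top_of_le_ne_top (ENNReal.ofReal_ne_top (r := ∑' n, levelSum A K u n)) ?_
  rw [ENNReal.ofReal_tsum_of_nonneg levelSum_nonneg h]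
  refine (ENNReal.tsum_iUnion_le_tsum (fun w => ENNReal.ofReal (wordNorm A w ^ u)) _).trans
    (ENNReal.tsum_le_tsum fun n => le_of_eq ?_)
  rw [levelSum, ENNReal.ofReal_sum_of_nonneg fun _ _ => Real.rpow_nonneg (wordNorm_nonneg _) _,
    ← Finset.tsum_subtype' _ fun w => ENNReal.ofReal (wordNorm A w ^ u), Set.Finite.coe_toFinset]

/-- The covering numbers of `E_K` at scale `r` are `O(r ^ (-u))` when the sum of `‖A_w‖^u` over all
words of `K` converges. -/
theorem exists_externalCoveringNumber_mul_rpow_le (hd : 1 ≤ d) (hA_inv : ∀ k, IsUnit (A k))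
    (hA : ∀ k, ‖euclideanMap (A k)‖ < 1) {u : ℝ} (hu : 0 < u)
    (hsum : Summable (levelSum A K u)) :
    ∃ B : ℝ≥0∞, B ≠ ⊤ ∧ ∀ᶠ r : ℝ≥0 in 𝓝[>] 0,
      ((externalCoveringNumber r (limitSet A a K) : ℕ∞) : ℝ≥0∞) * (r : ℝ≥0∞) ^ u ≤ B := by
  obtain ⟨R, hR0, hR⟩ := exists_dist_projection_le hA a
  obtain ⟨C, hC1, hC⟩ := exists_wordNorm_le_mul_wordNorm_append hA_inv
  set D := ENNReal.ofReal (R * C) with hD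
  set V := ∑' w : ⋃ n, levelWords K n, ENNReal.ofReal (wordNorm A w ^ u)
  refine ⟨V * D ^ u, ENNReal.mul_ne_top (tsum_words_ne_top hsum)
    (ENNReal.rpow_ne_top_of_nonneg hu.le ENNReal.ofReal_ne_top), ?_⟩
  have hRev : ∀ᶠ r : ℝ≥0 in 𝓝[>] 0, (r : ℝ) < R :=
    mem_nhdsWithin_of_mem_nhds ((NNReal.continuous_coe.tendsto 0).eventually_lt_const (by simpa))
  filter_upwards [self_mem_nhdsWithin, hRev] with r hr hrR
  have hr0 : (0 : ℝ) < r := hr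
  -- Stopping by norm instead of diameter bounds the weight below, since `r < R ‖A_{w⁻}‖ ≤ R C
  -- ‖A_w‖`. It also gives `diam E_w ≤ R ‖A_w‖ ≤ r`, so one ball of radius `r` about any point of
  -- `E_w` covers it.
  set Z : Set (List I) := {w | ∃ i ∈ K, ∃ n, initialWord i (n + 1) = w ∧ R * wordNorm A w ≤ r ∧
    r < R * wordNorm A (initialWord i n)} with hZ
  have hZV : ∑' w : Z, ENNReal.ofReal (wordNorm A w ^ u) ≤ V := by
    refine ENNReal.tsum_mono_subtype (fun w => ENNReal.ofReal (wordNorm A w ^ u)) ?_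
    rintro w ⟨i, hi, n, rfl, -⟩
    exact Set.mem_iUnion.2 ⟨n + 1, i, hi, rfl⟩
  have hZr : ∀ w ∈ Z, (r : ℝ≥0∞) ^ u ≤ D ^ u * ENNReal.ofReal (wordNorm A w ^ u) := by
    rintro w ⟨i, hi, n, rfl, -, h⟩
    rw [hD, ← ENNReal.ofReal_rpow_of_nonneg (wordNorm_nonneg _) hu.le,
      ← ENNReal.mul_rpow_of_nonneg _ _ hu.le, ← ENNReal.ofReal_mul (by positivity),
      ← ENNReal.ofReal_coe_nnreal]
    refine ENNReal.rpow_le_rpow (ENNReal.ofReal_le_ofReal ?_) hu.le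
    rw [initialWord_succ, mul_assoc]
    exact h.le.trans (mul_le_mul_of_nonneg_left (hC _ _) hR0.le)
  have hcov : externalCoveringNumber r (limitSet A a K) ≤ Z.encard := by
    have hsel : ∀ w, ∃ y, w ∈ Z → ∃ i ∈ cylinder w, projection A a i = y := by
      intro w
      by_cases hw : w ∈ Z
      · obtain ⟨i, -, n, rfl, -⟩ := hw
        exact ⟨_, fun _ => ⟨i, mem_cylinder_initialWord i _, rfl⟩⟩
      · exact ⟨0, fun h => absurd h hw⟩
    choose f hf using hsel
    refine le_trans (IsCover.externalCoveringNumber_le_encard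
      (C := f '' Z) ?_) (Set.encard_image_le _ _)
    rintro _ ⟨i, hi, rfl⟩
    obtain ⟨n, hn, hn'⟩ := exists_initialWord_crossing (f := fun w => R * wordNorm A w) hr0
      (by simpa [wordNorm_nil hd] using hrR)
      (by simpa using (tendsto_wordNorm_initialWord hA i).const_mul R)
    have hw : initialWord i (n + 1) ∈ Z := ⟨i, hi, n, rfl, hn, hn'⟩
    obtain ⟨j, hj, hfj⟩ := hf _ hw
    refine ⟨_, ⟨_, hw, rfl⟩, ?_⟩
    rw [← hfj]
    change edist _ _ ≤ _
    rw [edist_dist, ← ENNReal.ofReal_coe_nnreal]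
    exact ENNReal.ofReal_le_ofReal
      ((hR _ i (mem_cylinder_initialWord i _) j hj).trans hn)
  calc ((externalCoveringNumber r (limitSet A a K) : ℕ∞) : ℝ≥0∞) * (r : ℝ≥0∞) ^ u
      ≤ (Z.encard : ℝ≥0∞) * (r : ℝ≥0∞) ^ u := by
        gcongr
    _ = ∑' _ : Z, (r : ℝ≥0∞) ^ u := (ENNReal.tsum_set_const _ _).symm
    _ ≤ ∑' w : Z, D ^ u * ENNReal.ofReal (wordNorm A w ^ u) :=
        ENNReal.tsum_le_tsum fun w => hZr w w.2
    _ = D ^ u * ∑' w : Z, ENNReal.ofReal (wordNorm A w ^ u) := ENNReal.tsum_mul_left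
    _ ≤ V * D ^ u := by rw [mul_comm]; gcongr

/-- The upper bound for the upper Minkowski dimension. -/
theorem upperMinkowskiDim_limitSet_le (hd : 1 ≤ d) (hA_inv : ∀ k, IsUnit (A k))
    (hA : ∀ k, ‖euclideanMap (A k)‖ < 1) {s : ℝ} (hs : 0 < s)
    (hS : ∀ ε > 0, ∀ᶠ n : ℕ in atTop, levelSum A K s n ≤ Real.exp (n * ε)) :
    upperMinkowskiDim (limitSet A a K) ≤ ENNReal.ofReal s := by
  refine ENNReal.le_of_forall_pos_le_add fun t ht _ => ?_
  rw [ENNReal.ofReal, ← ENNReal.coe_add]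
  refine iInf₂_le (s.toNNReal + t) ?_
  have ht' : (0 : ℝ) < t := ht
  -- Midway between `s` and `s + t`: boundedness of `N(r) r ^ u` leaves a spare factor `r ^ (t / 2)`
  -- tending to zero.
  set u : ℝ := s + t / 2
  have hu0 : 0 < u := by positivity
  obtain ⟨B, hB, hev⟩ := exists_externalCoveringNumber_mul_rpow_le (a := a) hd hA_inv hA
    hu0 (summable_levelSum hA hs (by simp [u, ht'] : s < u) hS)
  have h0 : Tendsto (fun r : ℝ≥0 => B * (r : ℝ≥0∞) ^ ((t : ℝ) / 2)) (𝓝[>] 0) (𝓝 0) := by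
    have h1 : Tendsto (fun r : ℝ≥0 => (r : ℝ≥0∞) ^ ((t : ℝ) / 2)) (𝓝[>] 0) (𝓝 0) := by
      have h2 : Tendsto (fun r : ℝ≥0 => (r : ℝ≥0∞)) (𝓝[>] 0) (𝓝 0) :=
        (ENNReal.continuous_coe.tendsto 0).mono_left nhdsWithin_le_nhds
      have h3 := (ENNReal.continuous_rpow_const (y := (t : ℝ) / 2)).tendsto 0
      rw [ENNReal.zero_rpow_of_pos (by positivity)] at h3
      exact h3.comp h2
    simpa using ENNReal.Tendsto.const_mul h1 (Or.inr hB)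
  refine (tendsto_of_tendsto_of_tendsto_of_le_of_le' tendsto_const_nhds h0
    (Eventually.of_forall fun _ => bot_le) ?_).limsup_eq
  filter_upwards [hev] with r hr
  have hexp : ((s.toNNReal + t : ℝ≥0) : ℝ) = u + t / 2 := by
    rw [NNReal.coe_add, Real.coe_toNNReal s hs.le]
    simp only [u]; ring
  rw [hexp, ENNReal.rpow_add_of_nonneg _ _ hu0.le (by positivity), ← mul_assoc]
  gcongr

end

end SubSelfAffine

end

/-! ### The dimension formula -/

theorem mainTheorem5 {I : Type*} [Finite I] [TopologicalSpace I] [DiscreteTopology I]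
    {d : ℕ} (hd : 1 ≤ d)
    (A : I → Matrix (Fin d) (Fin d) ℝ) (a : I → EuclideanSpace ℝ (Fin d))
    (hA_inv : ∀ i, IsUnit (A i)) (hA_norm : ∀ i, ‖SubSelfAffine.euclideanMap (A i)‖ < 1)
    (K : Set (ℕ → I)) (hK_ne : K.Nonempty) (hK_compact : IsCompact K)
    (hK_shift : SubSelfAffine.shift '' K ⊆ K)
    (h_tract : SubSelfAffine.IsTractable A a K)
    (h_ball : SubSelfAffine.BallCondition A a K)
    (s : ℝ) (hs_pos : 0 < s) (hs_le : s ≤ 1) (h_press : SubSelfAffine.pressure A K s = 0) :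
    dimH (SubSelfAffine.limitSet A a K) = ENNReal.ofReal s ∧
      SubSelfAffine.upperMinkowskiDim (SubSelfAffine.limitSet A a K) = ENNReal.ofReal s := by
  obtain ⟨hS1, hS2⟩ := SubSelfAffine.levelSum_of_pressure_eq_zero hd hA_inv hK_ne hK_shift
    hs_pos hs_le h_press
  have hlow := SubSelfAffine.ofReal_le_dimH_limitSet hd hA_norm hK_ne hK_compact hK_shift
    h_tract.not_subset_hyperplane h_ball hs_pos hs_le hS1
  have hmid := SubSelfAffine.dimH_le_upperMinkowskiDim (SubSelfAffine.limitSet A a K)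
  have hupp := SubSelfAffine.upperMinkowskiDim_limitSet_le (a := a) hd hA_inv hA_norm hs_pos hS2
  exact ⟨le_antisymm (hmid.trans hupp) hlow, le_antisymm hupp (hlow.trans hmid)⟩
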